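/- Let $n\ge 0$ be an integer, let $B^n=\{z\in\mathbb C^n:\|z\|<1\}$ (Euclidean norm), let $U\subseteq\mathbb C^n$ be an open neighborhood of the origin, and let $X=\sum_{j=1}^n X_j\,\frac{\partial}{\partial z_j}$ be a holomorphic vector field on $U$, that is, the functions $X_j\colon U\to\mathbb C$ are holomorphic. Assume that $X$ is contracting at the origin: for some $t<0$, the time-$t$ map $\Phi_t$ of the flow of the real vector field $\operatorname{Re}X=\frac12(X+\overline X)$ is defined on a neighborhood of $0$ (with the flow curves staying in $U$ for all times in $[t,0]$), $\Phi_t(0)=0$, and every eigenvalue of the complex matrix $d\Phi_t|_0$ has absolute value less than $1$. Let $f\colon B^n\to\mathbb C$ be a real-analytic function such that $$\overline X f=\sum_{j=1}^n\overline{X_j}\,\frac{\partial f}{\partial\bar z_j}=0\quad\text{at every point of } U\cap B^n,$$ where $\frac{\partial}{\partial\bar z_j}=\frac12\left(\frac{\partial}{\partial x_j}+i\frac{\partial}{\partial y_j}\right)$ and $z_j=x_j+iy_j$. Then $f$ is holomorphic on $B^n$. -/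

import Mathlib

/-- The Wirtinger derivative `∂f/∂z̄_j = (∂f/∂x_j + i ∂f/∂y_j) / 2` at `z`, where
`z_j = x_j + i y_j`. -/
noncomputable def wirtingerBar {n : ℕ} (f : EuclideanSpace ℂ (Fin n) → ℂ) (j : Fin n)
    (z : EuclideanSpace ℂ (Fin n)) : ℂ :=
  (1 / 2 : ℂ) *
    (fderiv ℝ f z (EuclideanSpace.single j (1 : ℂ)) +
      Complex.I * fderiv ℝ f z (EuclideanSpace.single j Complex.I))

/-- For `X = ∑ X_j ∂/∂z_j`, the function `X̄ f = ∑ conj (X_j) ∂f/∂z̄_j`. -/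
noncomputable def conjVectorFieldApply {n : ℕ}
    (X : EuclideanSpace ℂ (Fin n) → EuclideanSpace ℂ (Fin n))
    (f : EuclideanSpace ℂ (Fin n) → ℂ) (z : EuclideanSpace ℂ (Fin n)) : ℂ :=
  ∑ j : Fin n, (starRingEnd ℂ) (X z j) * wirtingerBar f j z

/-- The velocity of the real vector field `Re X = (X + X̄) / 2`, where `X = ∑ X_j ∂/∂z_j`.
Since `(Re X) z_j = X_j / 2`, its integral curves are the solutions of `z' = X(z) / 2`. -/
noncomputable def reVelocity {n : ℕ}
    (X : EuclideanSpace ℂ (Fin n) → EuclideanSpace ℂ (Fin n)) (z : EuclideanSpace ℂ (Fin n)) :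
    EuclideanSpace ℂ (Fin n) :=
  (1 / 2 : ℂ) • X z

/-- `Φ` is the flow of `Re X` (for `X` defined on `U`), on the set `V` of initial points, for
times in `[t, 0]`: each `s ↦ Φ s p` is an integral curve of `Re X` inside `U` that starts
at `p` at time `0`. -/
def IsBackwardFlowOfRe {n : ℕ} (U : Set (EuclideanSpace ℂ (Fin n)))
    (X : EuclideanSpace ℂ (Fin n) → EuclideanSpace ℂ (Fin n))
    (V : Set (EuclideanSpace ℂ (Fin n))) (t : ℝ)
    (Φ : ℝ → EuclideanSpace ℂ (Fin n) → EuclideanSpace ℂ (Fin n)) : Prop :=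
  ∀ p ∈ V, Φ 0 p = p ∧ (∀ s ∈ Set.Icc t 0, Φ s p ∈ U) ∧
    IsIntegralCurveOn (fun s : ℝ => Φ s p) (fun _ => reVelocity X) (Set.Icc t 0)

/-- `X`, a vector field on `U ∋ 0`, is contracting at the origin: for some `t < 0` the time-`t`
map `Φ_t` of the flow of `Re X`, defined near `0`, fixes `0`, and all eigenvalues of its
complex differential at `0` have absolute value less than `1`. -/
def IsContractingAtOrigin {n : ℕ} (U : Set (EuclideanSpace ℂ (Fin n)))
    (X : EuclideanSpace ℂ (Fin n) → EuclideanSpace ℂ (Fin n)) : Prop :=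
  ∃ t : ℝ, t < 0 ∧
    ∃ (V : Set (EuclideanSpace ℂ (Fin n)))
      (Φ : ℝ → EuclideanSpace ℂ (Fin n) → EuclideanSpace ℂ (Fin n)),
      IsOpen V ∧ 0 ∈ V ∧ IsBackwardFlowOfRe U X V t Φ ∧ Φ t 0 = 0 ∧
      ∃ L : EuclideanSpace ℂ (Fin n) →L[ℂ] EuclideanSpace ℂ (Fin n),
        HasFDerivAt (Φ t) L 0 ∧
        ∀ μ : ℂ, Module.End.HasEigenvalue
          (L : EuclideanSpace ℂ (Fin n) →ₗ[ℂ] EuclideanSpace ℂ (Fin n)) μ → ‖μ‖ < 1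

/-! Near 0, polarize: `f z = F (z, z̄)` with `F` holomorphic in `(z, w)`
(`AnalyticAt.exists_polarization`). Then `X̄ f` is the restriction to `w = z̄` of the derivative of
`F` along `(0, conj (X (conj w)))`. This is holomorphic in `(z, w)`, so its vanishing on the totally
real subspace `w = z̄` makes it vanish near 0 (`eventually_eq_zero_of_eq_zero_on_conj`).

Hence, for fixed `z`, the function `w ↦ F (z, w̄)` is constant along the flow of `Re X` and
invariant under `Φ t`. An iterate of `Φ t` contracts to 0, so this function is constant near 0
(`eventually_eq_of_invariant`), and `w = z` gives `f z = F (z, 0)`, which is holomorphic. Orbits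
must not leave the domain of `F` before time `t`; this follows from `X 0 = 0`, which holds because 1
is not an eigenvalue of the differential (`eq_zero_of_flow_fixes_zero`).

The identity theorem for real-analytic functions carries the Cauchy–Riemann equations from this
neighborhood to the ball. -/

open Filter Topology Set
open scoped NNReal ENNReal

/-! ### Complexification of real-analytic germs -/

/-- The complex-multilinear extension to `ι → ℂ` of a real-multilinear map on `ι → ℝ`. -/
noncomputable def ContinuousMultilinearMap.complexExtend {ι : Type*} [Fintype ι] [DecidableEq ι]
    {m : ℕ} (p : ContinuousMultilinearMap ℝ (fun _ : Fin m => ι → ℝ) ℂ) :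
    ContinuousMultilinearMap ℂ (fun _ : Fin m => ι → ℂ) ℂ :=
  ∑ r : Fin m → ι, p (fun i => Pi.single (r i) 1) •
    (ContinuousMultilinearMap.mkPiAlgebra ℂ (Fin m) ℂ).compContinuousLinearMap
      (fun i => ContinuousLinearMap.proj (R := ℂ) (φ := fun _ : ι => ℂ) (r i))

theorem ContinuousMultilinearMap.complexExtend_apply {ι : Type*} [Fintype ι] [DecidableEq ι]
    {m : ℕ} (p : ContinuousMultilinearMap ℝ (fun _ : Fin m => ι → ℝ) ℂ) (v : Fin m → ι → ℂ) :
    p.complexExtend v = ∑ r : Fin m → ι, p (fun i => Pi.single (r i) 1) * ∏ i, v i (r i) := by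
  simp [complexExtend]

theorem ContinuousMultilinearMap.complexExtend_ofReal {ι : Type*} [Fintype ι] [DecidableEq ι]
    {m : ℕ} (p : ContinuousMultilinearMap ℝ (fun _ : Fin m => ι → ℝ) ℂ) (v : Fin m → ι → ℝ) :
    p.complexExtend (fun i j => (v i j : ℂ)) = p v := by
  have hv : v = fun i => ∑ j, v i j • (Pi.single j (1 : ℝ) : ι → ℝ) := by
    ext i k
    simp [Finset.sum_apply, Pi.single_apply]
  rw [complexExtend_apply]
  conv_rhs => rw [hv, ContinuousMultilinearMap.map_sum]
  refine Finset.sum_congr rfl fun r _ => ?_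
  rw [ContinuousMultilinearMap.map_smul_univ, Complex.real_smul, mul_comm]
  push_cast
  rfl

/-- The factor counts the index tuples `r`. It is geometric in `m`, so extending a power series
termwise keeps a positive radius of convergence. -/
theorem ContinuousMultilinearMap.norm_complexExtend_le {ι : Type*} [Fintype ι] [DecidableEq ι]
    {m : ℕ} (p : ContinuousMultilinearMap ℝ (fun _ : Fin m => ι → ℝ) ℂ) :
    ‖p.complexExtend‖ ≤ (Fintype.card ι : ℝ) ^ m * ‖p‖ := by
  refine ContinuousMultilinearMap.opNorm_le_bound (by positivity) fun v => ?_
  rw [complexExtend_apply]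
  have key : ∀ r : Fin m → ι, ‖p (fun i => Pi.single (r i) 1) * ∏ i, v i (r i)‖
      ≤ ‖p‖ * ∏ i, ‖v i‖ := by
    intro r
    rw [norm_mul, norm_prod]
    refine mul_le_mul ?_ (Finset.prod_le_prod (fun _ _ => norm_nonneg _)
      fun i _ => norm_le_pi_norm _ _) (by positivity) (norm_nonneg _)
    refine (p.le_opNorm _).trans ?_
    simp [Pi.norm_single]
  refine (norm_sum_le_of_le _ fun r _ => key r).trans ?_
  simp [mul_assoc]

/-- A real-analytic germ at `0 ∈ ℝ^ι` extends to a complex-analytic germ at `0 ∈ ℂ^ι`. -/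
theorem AnalyticAt.exists_complex_extension {ι : Type*} [Fintype ι] {f : (ι → ℝ) → ℂ}
    (hf : AnalyticAt ℝ f 0) :
    ∃ F : (ι → ℂ) → ℂ, AnalyticAt ℂ F 0 ∧ ∀ᶠ x in 𝓝 (0 : ι → ℝ), F (fun i => (x i : ℂ)) = f x := by
  classical
  obtain ⟨p, R, hp⟩ := hf
  let q : FormalMultilinearSeries ℂ (ι → ℂ) ℂ := fun m => (p m).complexExtend
  have hq : 0 < q.radius := by
    obtain ⟨r, hr0, hr⟩ := ENNReal.lt_iff_exists_nnreal_btwn.1 (hp.r_pos.trans_le hp.r_le)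
    obtain ⟨C, hC, hCr⟩ := p.norm_mul_pow_le_of_lt_radius hr
    have hr0' : 0 < r := by exact_mod_cast hr0
    -- The `+ 1` keeps `c` positive when `ι` is empty.
    let c : ℝ≥0 := (Fintype.card ι : ℝ≥0) + 1
    have hc : 0 < c := by positivity
    refine lt_of_lt_of_le ?_ (q.le_radius_of_bound (r := r / c) C fun m => ?_)
    · exact_mod_cast div_pos hr0' hc
    · refine le_trans ?_ (hCr m)
      have h1 : ‖q m‖ ≤ (c : ℝ) ^ m * ‖p m‖ := by
        refine ((p m).norm_complexExtend_le).trans ?_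
        gcongr
        simp [c]
      have hc' : (0 : ℝ) < c := by exact_mod_cast hc
      calc ‖q m‖ * ((r / c : ℝ≥0) : ℝ) ^ m ≤ ((c : ℝ) ^ m * ‖p m‖) * ((r / c : ℝ≥0) : ℝ) ^ m := by
            gcongr
        _ = ‖p m‖ * (r : ℝ) ^ m := by
            rw [NNReal.coe_div, div_pow]
            field_simp
  refine ⟨q.sum, (q.hasFPowerSeriesOnBall hq).analyticAt, ?_⟩
  filter_upwards [Metric.eball_mem_nhds (0 : ι → ℝ) hp.r_pos] with x hx
  have h := hp.hasSum hx
  rw [zero_add] at h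
  rw [FormalMultilinearSeries.sum, ← h.tsum_eq]
  exact tsum_congr fun m => (p m).complexExtend_ofReal fun _ => x

/-! ### Conjugation and polarization -/

/-- Coordinatewise complex conjugation on `ℂⁿ`. -/
noncomputable def conjEuclidean (n : ℕ) :
    EuclideanSpace ℂ (Fin n) →L⋆[ℂ] EuclideanSpace ℂ (Fin n) where
  toFun z := WithLp.toLp 2 fun j => (starRingEnd ℂ) (z j)
  map_add' x y := by ext; simp
  map_smul' c x := by ext; simp
  cont := by fun_prop

@[simp]
theorem conjEuclidean_apply {n : ℕ} (z : EuclideanSpace ℂ (Fin n)) (j : Fin n) :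
    conjEuclidean n z j = (starRingEnd ℂ) (z j) := rfl

@[simp]
theorem conjEuclidean_conjEuclidean {n : ℕ} (z : EuclideanSpace ℂ (Fin n)) :
    conjEuclidean n (conjEuclidean n z) = z := by
  ext; simp

@[simp]
theorem norm_conjEuclidean {n : ℕ} (z : EuclideanSpace ℂ (Fin n)) :
    ‖conjEuclidean n z‖ = ‖z‖ := by
  simp [EuclideanSpace.norm_eq]

/-- `conjEuclidean` as a real-linear map. -/
noncomputable def conjEuclideanReal (n : ℕ) :
    EuclideanSpace ℂ (Fin n) →L[ℝ] EuclideanSpace ℂ (Fin n) where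
  toFun := conjEuclidean n
  map_add' := map_add _
  map_smul' c x := by ext; simp
  cont := (conjEuclidean n).continuous

@[simp]
theorem conjEuclideanReal_apply {n : ℕ} (z : EuclideanSpace ℂ (Fin n)) :
    conjEuclideanReal n z = conjEuclidean n z := rfl

/-- A real-analytic germ at `0 ∈ ℂⁿ` is the restriction of a holomorphic germ in `(z, w)` to the
totally real subspace `w = z̄`. -/
theorem AnalyticAt.exists_polarization {n : ℕ} {f : EuclideanSpace ℂ (Fin n) → ℂ}
    (hf : AnalyticAt ℝ f 0) :
    ∃ F : EuclideanSpace ℂ (Fin n) × EuclideanSpace ℂ (Fin n) → ℂ, AnalyticAt ℂ F 0 ∧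
      ∀ᶠ z in 𝓝 (0 : EuclideanSpace ℂ (Fin n)), F (z, conjEuclidean n z) = f z := by
  let A : (Fin n ⊕ Fin n → ℝ) →L[ℝ] EuclideanSpace ℂ (Fin n) :=
    LinearMap.toContinuousLinearMap
      { toFun := fun x => WithLp.toLp 2 fun j => (x (.inl j) : ℂ) + x (.inr j) * Complex.I
        map_add' := fun x y => by ext; simp; ring
        map_smul' := fun c x => by ext; simp; ring }
  let B : EuclideanSpace ℂ (Fin n) →L[ℝ] (Fin n ⊕ Fin n → ℝ) :=
    LinearMap.toContinuousLinearMap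
      { toFun := fun z => Sum.elim (fun j => (z j).re) (fun j => (z j).im)
        map_add' := fun x y => by ext (j | j) <;> simp
        map_smul' := fun c x => by ext (j | j) <;> simp }
  -- On `w = z̄` the complex-linear map `T` returns the real coordinates `B z`, so composing it with
  -- the complexification of `f ∘ A` gives `F`.
  let T : EuclideanSpace ℂ (Fin n) × EuclideanSpace ℂ (Fin n) →L[ℂ] (Fin n ⊕ Fin n → ℂ) :=
    LinearMap.toContinuousLinearMap
      { toFun := fun z => Sum.elim (fun j => (z.1 j + z.2 j) / 2)
          (fun j => (z.1 j - z.2 j) / (2 * Complex.I))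
        map_add' := fun x y => by ext (j | j) <;> simp <;> ring
        map_smul' := fun c x => by ext (j | j) <;> simp <;> ring }
  have hAB : ∀ z, A (B z) = z := by
    intro z
    ext j
    exact Complex.re_add_im (z j)
  have hTB : ∀ z, T (z, conjEuclidean n z) = fun i => ((B z i : ℝ) : ℂ) := by
    intro z
    ext (j | j)
    · exact (Complex.re_eq_add_conj (z j)).symm
    · exact (Complex.im_eq_sub_conj (z j)).symm
  obtain ⟨G, hG, hGf⟩ := AnalyticAt.exists_complex_extension (f := f ∘ A)
    (AnalyticAt.comp (by simpa using hf) (A.analyticAt 0))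
  refine ⟨G ∘ T, AnalyticAt.comp (by simpa using hG) (T.analyticAt 0), ?_⟩
  have hB : Tendsto B (𝓝 0) (𝓝 0) := by simpa using B.continuous.tendsto 0
  filter_upwards [hB.eventually hGf] with z hz
  rw [Function.comp_apply, hTB, hz, Function.comp_apply, hAB]

/-- A function holomorphic near `0 ∈ ℂⁿ × ℂⁿ` which vanishes on `w = z̄` near `0` vanishes
near `0`. -/
theorem eventually_eq_zero_of_eq_zero_on_conj {n : ℕ}
    {K : EuclideanSpace ℂ (Fin n) × EuclideanSpace ℂ (Fin n) → ℂ}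
    (hK : ∀ᶠ x in 𝓝 0, DifferentiableAt ℂ K x)
    (h0 : ∀ᶠ z in 𝓝 (0 : EuclideanSpace ℂ (Fin n)), K (z, conjEuclidean n z) = 0) :
    ∀ᶠ x in 𝓝 0, K x = 0 := by
  obtain ⟨ρ, hρ, hρK⟩ := Metric.eventually_nhds_iff_ball.1 hK
  obtain ⟨δ, hδ, hδK⟩ := Metric.eventually_nhds_iff_ball.1 h0
  set ε := min ρ δ / 4 with hε
  have hε0 : 0 < ε := by positivity
  have hερ : 4 * ε ≤ ρ := by rw [hε]; linarith [min_le_left ρ δ]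
  have hεδ : 4 * ε ≤ δ := by rw [hε]; linarith [min_le_right ρ δ]
  filter_upwards [Metric.ball_mem_nhds (0 : EuclideanSpace ℂ (Fin n) × EuclideanSpace ℂ (Fin n)) hε0]
    with ⟨a, b⟩ hab
  have hab' : ‖a‖ < ε ∧ ‖b‖ < ε := by
    rw [mem_ball_zero_iff, Prod.norm_def] at hab
    exact max_lt_iff.1 hab
  -- The complex line `ζ ↦ (x + ζ y, x̄ + ζ ȳ)` lies in the graph of conjugation for real `ζ` and
  -- passes through `(a, b)` at `ζ = i`; the one-variable identity theorem on `|ζ| < 2` applies.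
  let x : EuclideanSpace ℂ (Fin n) := (1 / 2 : ℂ) • (a + conjEuclidean n b)
  let y : EuclideanSpace ℂ (Fin n) := (-Complex.I / 2) • (a - conjEuclidean n b)
  have hx : ‖x‖ < ε := by
    have : ‖a + conjEuclidean n b‖ ≤ ‖a‖ + ‖b‖ := by simpa using norm_add_le a (conjEuclidean n b)
    simp only [x, norm_smul]
    norm_num
    linarith
  have hy : ‖y‖ < ε := by
    have : ‖a - conjEuclidean n b‖ ≤ ‖a‖ + ‖b‖ := by simpa using norm_sub_le a (conjEuclidean n b)
    simp only [y, norm_smul]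
    norm_num
    linarith
  have hbound : ∀ ζ : ℂ, ‖ζ‖ < 2 → ‖x + ζ • y‖ < 4 * ε ∧
      ‖conjEuclidean n x + ζ • conjEuclidean n y‖ < 4 * ε := by
    intro ζ hζ
    have h2 : ‖ζ‖ * ‖y‖ ≤ 2 * ε := by gcongr
    constructor
    · refine (norm_add_le _ _).trans_lt ?_
      rw [norm_smul ζ y]; linarith
    · refine (norm_add_le _ _).trans_lt ?_
      rw [norm_smul ζ, norm_conjEuclidean, norm_conjEuclidean]; linarith
  let k : ℂ → ℂ := fun ζ => K (x + ζ • y, conjEuclidean n x + ζ • conjEuclidean n y)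
  have hk : DifferentiableOn ℂ k (Metric.ball 0 2) := by
    intro ζ hζ
    rw [mem_ball_zero_iff] at hζ
    obtain ⟨h1, h2⟩ := hbound ζ hζ
    have h3 := hρK (x + ζ • y, conjEuclidean n x + ζ • conjEuclidean n y) (by
      rw [mem_ball_zero_iff, Prod.norm_def]
      exact max_lt (h1.trans_le hερ) (h2.trans_le hερ))
    exact (DifferentiableAt.comp (g := K) ζ h3 (by fun_prop)).differentiableWithinAt
  have hreal : ∀ s : ℝ, |s| < 2 → k s = 0 := by
    intro s hs
    have h1 := (hbound s (by simpa using hs)).1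
    have := hδK (x + (s : ℂ) • y) (by
      rw [mem_ball_zero_iff]; exact h1.trans_le hεδ)
    have hs : conjEuclidean n ((s : ℂ) • y) = (s : ℂ) • conjEuclidean n y := by
      rw [map_smulₛₗ, Complex.conj_ofReal]
    rwa [map_add, hs] at this
  have hfreq : ∃ᶠ ζ in 𝓝[≠] (0 : ℂ), k ζ = 0 := by
    have htend : Tendsto (fun s : ℝ => (s : ℂ)) (𝓝[≠] 0) (𝓝[≠] 0) := by
      refine tendsto_nhdsWithin_iff.2 ⟨?_, ?_⟩
      · exact (Complex.continuous_ofReal.tendsto' 0 0 (by simp)).mono_left nhdsWithin_le_nhds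
      · filter_upwards [self_mem_nhdsWithin] with s hs
        simpa using hs
    refine htend.frequently (Eventually.frequently ?_)
    have : ∀ᶠ s : ℝ in 𝓝 0, |s| < 2 := by
      filter_upwards [Metric.ball_mem_nhds (0 : ℝ) two_pos] with s hs
      simpa using hs
    filter_upwards [nhdsWithin_le_nhds this] with s hs using hreal s hs
  have hzero := (hk.analyticOnNhd Metric.isOpen_ball).eqOn_zero_of_preconnected_of_frequently_eq_zero
    (convex_ball (0 : ℂ) 2).isPreconnected (Metric.mem_ball_self two_pos) hfreq
    (x := Complex.I) (by simp)
  have h1 : x + Complex.I • y = a := by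
    ext j
    simp only [x, y, PiLp.add_apply, PiLp.smul_apply, PiLp.sub_apply, smul_eq_mul]
    linear_combination (-(a j - conjEuclidean n b j) / 2) * Complex.I_mul_I
  have h2 : conjEuclidean n x + Complex.I • conjEuclidean n y = b := by
    ext j
    simp [x, y, map_ofNat]
    linear_combination ((starRingEnd ℂ (a j) - b j) / 2) * Complex.I_mul_I
  simpa [k, h1, h2] using hzero

/-- If `f(z) = F(z, z̄)` near `z` with `F` holomorphic, then `X̄ f` is the derivative of `F` in the
direction `(0, conj X)`. -/
theorem conjVectorFieldApply_eq_fderiv {n : ℕ}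
    {F : EuclideanSpace ℂ (Fin n) × EuclideanSpace ℂ (Fin n) → ℂ}
    {f : EuclideanSpace ℂ (Fin n) → ℂ} {z : EuclideanSpace ℂ (Fin n)}
    (hF : DifferentiableAt ℂ F (z, conjEuclidean n z))
    (hfF : ∀ᶠ y in 𝓝 z, F (y, conjEuclidean n y) = f y)
    (X : EuclideanSpace ℂ (Fin n) → EuclideanSpace ℂ (Fin n)) :
    conjVectorFieldApply X f z =
      fderiv ℂ F (z, conjEuclidean n z) (0, conjEuclidean n (X z)) := by
  set D := fderiv ℂ F (z, conjEuclidean n z) with hD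
  have h1 : HasFDerivAt f ((D.restrictScalars ℝ).comp
      ((ContinuousLinearMap.id ℝ _).prod (conjEuclideanReal n))) z := by
    have h2 : HasFDerivAt F (D.restrictScalars ℝ) (z, conjEuclidean n z) :=
      hF.hasFDerivAt.restrictScalars ℝ
    have h3 : HasFDerivAt (fun y => (y, conjEuclidean n y))
        ((ContinuousLinearMap.id ℝ _).prod (conjEuclideanReal n)) z :=
      ((ContinuousLinearMap.id ℝ _).prod (conjEuclideanReal n)).hasFDerivAt
    exact (HasFDerivAt.comp z h2 h3).congr_of_eventuallyEq (hfF.mono fun y hy => hy.symm)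
  have hw : ∀ j, wirtingerBar f j z = D (0, EuclideanSpace.single j 1) := by
    intro j
    have e1 : conjEuclidean n (EuclideanSpace.single j (1 : ℂ)) = EuclideanSpace.single j 1 := by
      ext k; simp [apply_ite]
    have e2 : conjEuclidean n (EuclideanSpace.single j Complex.I) =
        (-Complex.I) • EuclideanSpace.single j 1 := by
      ext k; simp [apply_ite]
    have e3 : EuclideanSpace.single j Complex.I = Complex.I • EuclideanSpace.single j (1 : ℂ) := by
      ext k; simp
    have e4 : ∀ u v : EuclideanSpace ℂ (Fin n), D (u, v) = D (u, 0) + D (0, v) := by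
      intro u v
      rw [← map_add]; simp
    have e5 : ∀ (c : ℂ) (u : EuclideanSpace ℂ (Fin n)), D (c • u, 0) = c * D (u, 0) := by
      intro c u
      rw [← smul_eq_mul, ← map_smul]; simp
    have e6 : ∀ (c : ℂ) (u : EuclideanSpace ℂ (Fin n)), D (0, c • u) = c * D (0, u) := by
      intro c u
      rw [← smul_eq_mul, ← map_smul]; simp
    -- Since `1 + i·i = 0`, the `(e_j, 0)` terms cancel; conjugation turns `i e_j` into `-i e_j`, so
    -- the `(0, e_j)` terms add up.
    rw [wirtingerBar, h1.fderiv]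
    simp only [ContinuousLinearMap.comp_apply, ContinuousLinearMap.prod_apply,
      ContinuousLinearMap.id_apply, conjEuclideanReal_apply,
      ContinuousLinearMap.coe_restrictScalars', e1, e2]
    rw [e4, e4 (EuclideanSpace.single j Complex.I), e3, e5, e6]
    linear_combination (1 / 2 * (D (EuclideanSpace.single j 1, 0) - D (0, EuclideanSpace.single j 1)))
      * Complex.I_mul_I
  have hX : ((0 : EuclideanSpace ℂ (Fin n)), conjEuclidean n (X z)) =
      ∑ j, (starRingEnd ℂ) (X z j) •
        ((0 : EuclideanSpace ℂ (Fin n)), EuclideanSpace.single j (1 : ℂ)) := by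
    refine Prod.ext ?_ ?_
    · simp [Prod.fst_sum]
    · ext k
      simp [Prod.snd_sum, Pi.single_apply]
  rw [hX, map_sum, conjVectorFieldApply]
  refine Finset.sum_congr rfl fun j _ => ?_
  rw [map_smul, hw, smul_eq_mul]

/-! ### Integral curves and contracting fixed points -/

section Dynamics

variable {E F : Type*} [NormedAddCommGroup E] [NormedAddCommGroup F]

/-- Holomorphic maps are locally Lipschitz. -/
theorem DifferentiableOn.exists_lipschitzOnWith_ball [NormedSpace ℂ E] [NormedSpace ℂ F]
    {X : E → F} {U : Set E} (hX : DifferentiableOn ℂ X U) (hU : IsOpen U) {x : E} (hx : x ∈ U) :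
    ∃ r > 0, ∃ K : ℝ≥0, Metric.ball x r ⊆ U ∧ LipschitzOnWith K X (Metric.ball x r) := by
  have hcont : ContinuousAt X x := (hX.continuousOn).continuousAt (hU.mem_nhds hx)
  obtain ⟨r, hr, hrU⟩ := Metric.eventually_nhds_iff_ball.1
    ((hU.eventually_mem hx).and (hcont.eventually (Metric.ball_mem_nhds (X x) one_pos)))
  -- Schwarz lemma on the ball of radius `2r/3` about `z`, where `X` stays within 2 of `X z`.
  refine ⟨r / 3, by positivity, ⟨2 / (r / 3 * 2), by positivity⟩,
    fun y hy => (hrU y (Metric.ball_subset_ball (by linarith) hy)).1, ?_⟩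
  refine LipschitzOnWith.of_dist_le_mul fun y hy z hz => ?_
  have hsub : Metric.ball z (r / 3 * 2) ⊆ Metric.ball x r :=
    Metric.ball_subset_ball' (by rw [Metric.mem_ball] at hz; linarith)
  refine Complex.dist_le_div_mul_dist_of_mapsTo_ball
    (hX.mono fun w hw => (hrU w (hsub hw)).1) (fun w hw => ?_) ?_
  · have h1 := (hrU w (hsub hw)).2
    have h2 := (hrU z (Metric.ball_subset_ball (by linarith) hz)).2
    rw [Metric.mem_closedBall]
    linarith [dist_triangle_right (X w) (X z) (X x)]
  · have := dist_triangle_right y z x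
    rw [Metric.mem_ball] at hy hz ⊢
    linarith

/-- Uniqueness of integral curves, backward in time, for a locally Lipschitz vector field. -/
theorem eqOn_Icc_of_hasDerivWithinAt [NormedSpace ℝ E] {v : E → E} {U : Set E}
    (hv : LocallyLipschitzOn U v) {a b : ℝ} {γ η : ℝ → E}
    (hγ : ∀ s ∈ Icc a b, HasDerivWithinAt γ (v (γ s)) (Icc a b) s)
    (hη : ∀ s ∈ Icc a b, HasDerivWithinAt η (v (η s)) (Icc a b) s)
    (hγU : ∀ s ∈ Icc a b, γ s ∈ U) (hηU : ∀ s ∈ Icc a b, η s ∈ U) (hb : γ b = η b) :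
    EqOn γ η (Icc a b) := by
  have hγc : ContinuousOn γ (Icc a b) := fun s hs => (hγ s hs).continuousWithinAt
  have hηc : ContinuousOn η (Icc a b) := fun s hs => (hη s hs).continuousWithinAt
  obtain ⟨K, hK⟩ := LocallyLipschitzOn.exists_lipschitzOnWith_of_compact
    ((isCompact_Icc.image_of_continuousOn hγc).union (isCompact_Icc.image_of_continuousOn hηc))
    (hv.mono (union_subset (image_subset_iff.2 hγU) (image_subset_iff.2 hηU)))
  have hside : ∀ {ξ : ℝ → E}, (∀ s ∈ Icc a b, HasDerivWithinAt ξ (v (ξ s)) (Icc a b) s) →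
      ∀ s ∈ Ioc a b, HasDerivWithinAt ξ (v (ξ s)) (Iic s) s := fun hξ s hs =>
    (hξ s (Ioc_subset_Icc_self hs)).mono_of_mem_nhdsWithin
      (mem_of_superset (Icc_mem_nhdsLE hs.1) (Icc_subset_Icc_right hs.2))
  exact ODE_solution_unique_of_mem_Icc_left (v := fun _ => v) (s := fun _ => γ '' Icc a b ∪ η '' Icc a b)
    (fun _ _ => hK) hγc (hside hγ) (fun s hs => .inl (mem_image_of_mem γ (Ioc_subset_Icc_self hs)))
    hηc (hside hη) (fun s hs => .inr (mem_image_of_mem η (Ioc_subset_Icc_self hs))) hb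

/-- Backward integral curves of a vector field with `‖v z‖ ≤ K ‖z‖` near `0` grow at most
exponentially. -/
theorem norm_lt_of_hasDerivWithinAt [NormedSpace ℝ E] {v : E → E} {K ρ δ t : ℝ} (hK : 0 ≤ K)
    (hδρ : δ * Real.exp ((K + 1) * (-t)) ≤ ρ)
    (hv : ∀ z, ‖z‖ < ρ → ‖v z‖ ≤ K * ‖z‖) {γ : ℝ → E}
    (hγ : ∀ s ∈ Icc t 0, HasDerivWithinAt γ (v (γ s)) (Icc t 0) s) (h0 : ‖γ 0‖ < δ) :
    ∀ s ∈ Icc t 0, ‖γ s‖ < ρ := by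
  -- The barrier `c * exp ((K + 1) τ)` must grow strictly faster than the curve where they touch:
  -- hence `c > 0` and `K + 1` in place of `K`.
  obtain ⟨c, hc0, hcδ⟩ := exists_between h0
  have hc : 0 < c := (norm_nonneg _).trans_lt hc0
  have hsmall : ∀ τ ≤ -t, c * Real.exp ((K + 1) * τ) < ρ := fun τ hτ =>
    calc c * Real.exp ((K + 1) * τ) ≤ c * Real.exp ((K + 1) * (-t)) := by gcongr
      _ < δ * Real.exp ((K + 1) * (-t)) := by gcongr
      _ ≤ ρ := hδρ
  have hder : ∀ τ ∈ Icc 0 (-t),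
      HasDerivWithinAt (fun τ => γ (-τ)) (-v (γ (-τ))) (Icc 0 (-t)) τ := by
    intro τ hτ
    have h1 : HasDerivWithinAt γ (v (γ (-τ))) (Icc t 0) (-τ) :=
      hγ (-τ) ⟨by linarith [hτ.2], by linarith [hτ.1]⟩
    have h2 := h1.scomp τ (hasDerivAt_neg τ).hasDerivWithinAt
      (s := Icc 0 (-t)) (fun x hx => ⟨by linarith [hx.2], by linarith [hx.1]⟩)
    simpa [Function.comp_def] using h2
  have hB : ∀ τ : ℝ, HasDerivAt (fun τ => c * Real.exp ((K + 1) * τ))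
      ((K + 1) * (c * Real.exp ((K + 1) * τ))) τ := by
    intro τ
    exact ((((hasDerivAt_id' τ).const_mul (K + 1)).exp).const_mul c).congr_deriv (by ring)
  have key := image_norm_le_of_norm_deriv_right_lt_deriv_boundary
    (fun τ hτ => (hder τ hτ).continuousWithinAt)
    (fun τ hτ => (hder τ (Ico_subset_Icc_self hτ)).mono_of_mem_nhdsWithin
      (mem_of_superset (Icc_mem_nhdsGE hτ.2) (Icc_subset_Icc_left hτ.1)))
    (B := fun τ => c * Real.exp ((K + 1) * τ)) (by simpa using hc0.le) hB (by
      intro τ hτ heq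
      have h1 := hsmall τ hτ.2.le
      have hpos : 0 < c * Real.exp ((K + 1) * τ) := by positivity
      rw [norm_neg]
      refine (hv _ (heq ▸ h1)).trans_lt ?_
      rw [heq]
      linarith)
  intro s hs
  have := key (x := -s) ⟨by linarith [hs.2], by linarith [hs.1]⟩
  rw [neg_neg] at this
  exact this.trans_lt (hsmall _ (by linarith [hs.1]))

/-- If all eigenvalues of `L` lie in the open unit disc, then some power of `L` has norm less
than `1 / 2`. -/
theorem exists_norm_pow_lt_half_of_eigenvalues [NormedSpace ℂ E] [FiniteDimensional ℂ E] (L : E →L[ℂ] E)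
    (hL : ∀ μ : ℂ, Module.End.HasEigenvalue (L : E →ₗ[ℂ] E) μ → ‖μ‖ < 1) :
    ∃ N : ℕ, ‖L ^ N‖ < 1 / 2 := by
  have : CompleteSpace E := FiniteDimensional.complete ℂ E
  have hspec : ∀ μ ∈ spectrum ℂ L, ‖μ‖ < 1 := by
    intro μ hμ
    apply hL
    rw [Module.End.hasEigenvalue_iff_mem_spectrum]
    have := AlgEquiv.spectrum_eq (Module.End.toContinuousLinearMap E (𝕜 := ℂ)) (L : E →ₗ[ℂ] E)
    rw [← this]
    exact hμ
  have hrad : spectralRadius ℂ L < 1 := by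
    rcases (spectrum ℂ L).eq_empty_or_nonempty with h | h
    · simp [spectralRadius, h]
    · obtain ⟨μ, hμ, hμr⟩ := spectrum.exists_nnnorm_eq_spectralRadius_of_nonempty h
      rw [← hμr]
      exact_mod_cast hspec μ hμ
  obtain ⟨r, hr1, hr2⟩ := ENNReal.lt_iff_exists_nnreal_btwn.1 hrad
  have hr2' : r < 1 := by exact_mod_cast hr2
  -- Gelfand's formula turns the bound on the spectral radius into a bound on powers.
  have hev := (spectrum.pow_nnnorm_pow_one_div_tendsto_nhds_spectralRadius L).eventually
    (gt_mem_nhds hr1)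
  have hev2 := (tendsto_pow_atTop_nhds_zero_of_lt_one r.2 hr2').eventually
    (gt_mem_nhds (show (0 : ℝ) < 1 / 2 by norm_num))
  obtain ⟨N, hN, hN2, hN3⟩ := (hev.and (hev2.and (eventually_gt_atTop 0))).exists
  refine ⟨N, lt_of_le_of_lt ?_ hN2⟩
  have h1 : (‖L ^ N‖₊ : ℝ≥0∞) ≤ (r : ℝ≥0∞) ^ N := by
    have h2 := ENNReal.rpow_le_rpow hN.le (show (0 : ℝ) ≤ N by positivity)
    rw [← ENNReal.rpow_mul, one_div, inv_mul_cancel₀ (by positivity), ENNReal.rpow_one,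
      ENNReal.rpow_natCast] at h2
    exact h2
  exact_mod_cast h1

/-- A family of functions invariant near `0` under a map with contracting differential at the fixed
point `0` is constant near `0`. -/
theorem eventually_eq_of_invariant [NormedSpace ℂ E] [FiniteDimensional ℂ E] {α β : Type*}
    [TopologicalSpace β] [T2Space β] {Ψ : E → E} {L : E →L[ℂ] E} (hΨ0 : Ψ 0 = 0)
    (hΨ : HasFDerivAt Ψ L 0)
    (hL : ∀ μ : ℂ, Module.End.HasEigenvalue (L : E →ₗ[ℂ] E) μ → ‖μ‖ < 1)
    {H : α → E → β} {Z : Set α} (hH : ∀ z ∈ Z, ContinuousAt (H z) 0)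
    (hinv : ∀ᶠ w in 𝓝 0, ∀ z ∈ Z, H z (Ψ w) = H z w) :
    ∀ᶠ w in 𝓝 0, ∀ z ∈ Z, H z w = H z 0 := by
  obtain ⟨N, hN⟩ := exists_norm_pow_lt_half_of_eigenvalues L hL
  have hiter : ∀ k, HasFDerivAt (Ψ^[k]) (L ^ k) 0 := fun k => hΨ.iterate hΨ0 k
  have hfix : ∀ k, Ψ^[k] 0 = 0 := fun k => Function.iterate_fixed hΨ0 k
  have hinvN : ∀ k, ∀ᶠ w in 𝓝 0, ∀ z ∈ Z, H z (Ψ^[k] w) = H z w := by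
    intro k
    induction k with
    | zero => simp
    | succ k ih =>
      have htend : Tendsto (Ψ^[k]) (𝓝 0) (𝓝 0) := by
        have := (hiter k).continuousAt.tendsto
        rwa [hfix k] at this
      filter_upwards [ih, htend.eventually hinv] with w h1 h2 z hz
      rw [Function.iterate_succ_apply', h2 z hz, h1 z hz]
  -- `3/4` is `1/2` from the norm of `L ^ N` plus `1/4` for the differentiability error. The ball
  -- found below is mapped into itself, so invariance can be iterated indefinitely on it.
  have hcontr : ∀ᶠ w in 𝓝 (0 : E), ‖Ψ^[N] w‖ ≤ 3 / 4 * ‖w‖ := by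
    have h1 := (hasFDerivAt_iff_isLittleO_nhds_zero.1 (hiter N)).bound
      (show (0 : ℝ) < 1 / 4 by norm_num)
    filter_upwards [h1] with w hw
    rw [zero_add, hfix, sub_zero] at hw
    have h2 : ‖(L ^ N) w‖ ≤ 1 / 2 * ‖w‖ := (L ^ N).le_of_opNorm_le hN.le w
    have h3 := norm_add_le (Ψ^[N] w - (L ^ N) w) ((L ^ N) w)
    rw [sub_add_cancel] at h3
    linarith
  obtain ⟨r, hr, hball⟩ := Metric.eventually_nhds_iff_ball.1 ((hinvN N).and hcontr)
  filter_upwards [Metric.ball_mem_nhds (0 : E) hr] with w hw z hz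
  rw [mem_ball_zero_iff] at hw
  have hm : ∀ m : ℕ, ‖(Ψ^[N])^[m] w‖ ≤ (3 / 4) ^ m * ‖w‖ ∧ H z ((Ψ^[N])^[m] w) = H z w := by
    intro m
    induction m with
    | zero => simp
    | succ m ih =>
      have hmem : (Ψ^[N])^[m] w ∈ Metric.ball (0 : E) r := by
        rw [mem_ball_zero_iff]
        refine ih.1.trans_lt (lt_of_le_of_lt ?_ hw)
        exact mul_le_of_le_one_left (norm_nonneg _) (pow_le_one₀ (by norm_num) (by norm_num))
      obtain ⟨h1, h2⟩ := hball _ hmem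
      rw [Function.iterate_succ_apply']
      refine ⟨h2.trans ?_, (h1 z hz).trans ih.2⟩
      calc 3 / 4 * ‖(Ψ^[N])^[m] w‖ ≤ 3 / 4 * ((3 / 4) ^ m * ‖w‖) := by gcongr; exact ih.1
        _ = (3 / 4) ^ (m + 1) * ‖w‖ := by ring
  have htend : Tendsto (fun m : ℕ => (Ψ^[N])^[m] w) atTop (𝓝 0) := by
    refine squeeze_zero_norm (fun m => (hm m).1) ?_
    simpa using (tendsto_pow_atTop_nhds_zero_of_lt_one (show (0 : ℝ) ≤ 3 / 4 by norm_num)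
      (by norm_num)).mul_const ‖w‖
  have h1 := (hH z hz).tendsto.comp htend
  exact tendsto_nhds_unique (tendsto_const_nhds.congr fun m => ((hm m).2).symm) h1

end Dynamics

/-! ### Flows near a fixed point of the time-`t` map -/

/-- Translating an integral curve of an autonomous vector field in time. -/
theorem hasDerivWithinAt_comp_add_Icc {E : Type*} [NormedAddCommGroup E] [NormedSpace ℝ E]
    {γ : ℝ → E} {v : E → E} {a b a' b' c : ℝ}
    (hγ : ∀ s ∈ Icc a b, HasDerivWithinAt γ (v (γ s)) (Icc a b) s) (ha : a ≤ a' + c)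
    (hb : b' + c ≤ b) :
    ∀ s ∈ Icc a' b', HasDerivWithinAt (fun s => γ (s + c)) (v (γ (s + c))) (Icc a' b') s := by
  intro s hs
  have h1 : HasDerivWithinAt (fun s => s + c) 1 (Icc a' b') s :=
    ((hasDerivAt_id' s).add_const c).hasDerivWithinAt
  have hmaps : MapsTo (fun s => s + c) (Icc a' b') (Icc a b) := fun x hx =>
    ⟨ha.trans (add_le_add_left hx.1 c), (add_le_add_left hx.2 c).trans hb⟩
  have h2 := (hγ (s + c) (hmaps hs)).scomp s h1 hmaps
  simpa [Function.comp_def] using h2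

/-- If the time-`t` map of a flow fixes `0` and its differential there does not have the
eigenvalue `1`, then `0` is a zero of the vector field: otherwise the flow would permute the points
of a periodic orbit through `0`. -/
theorem eq_zero_of_flow_fixes_zero {E : Type*} [NormedAddCommGroup E] [NormedSpace ℝ E]
    {v : E → E} {U V : Set E} (hv : LocallyLipschitzOn U v) {t : ℝ} (ht : t < 0) {Φ : ℝ → E → E}
    (hV : IsOpen V) (h0V : 0 ∈ V)
    (hΦ0 : ∀ p ∈ V, Φ 0 p = p) (hΦU : ∀ p ∈ V, ∀ s ∈ Icc t 0, Φ s p ∈ U)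
    (hΦ : ∀ p ∈ V, ∀ s ∈ Icc t 0,
      HasDerivWithinAt (fun s => Φ s p) (v (Φ s p)) (Icc t 0) s)
    (hfix : Φ t 0 = 0) {L : E →L[ℝ] E} (hL : HasFDerivAt (Φ t) L 0)
    (h1 : ∀ x, L x = x → x = 0) : v 0 = 0 := by
  have ht0 : (0 : ℝ) ∈ Icc t 0 := ⟨ht.le, le_rfl⟩
  have h00 : Φ 0 0 = 0 := hΦ0 0 h0V
  have hc := hΦ 0 h0V
  have hcV : ∀ᶠ σ in 𝓝[Icc t 0] 0, Φ σ 0 ∈ V := by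
    refine (hc 0 ht0).continuousWithinAt.eventually ?_
    exact hV.mem_nhds (by simpa [h00] using h0V)
  -- From `Φ σ 0`, time `t - σ` leads to `Φ t 0 = 0`, and the remaining time `σ` leads from 0 back
  -- to `Φ σ 0`. Differentiating this at `σ = 0` gives `L (v 0) = v 0`.
  have hperm : ∀ᶠ σ in 𝓝[Icc t 0] 0, Φ t (Φ σ 0) = Φ σ 0 := by
    filter_upwards [hcV, self_mem_nhdsWithin] with σ hσV hσ
    have hp := hΦ _ hσV
    have e1 : EqOn (fun s => Φ s (Φ σ 0)) (fun s => Φ (s + σ) 0) (Icc (t - σ) 0) := by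
      refine eqOn_Icc_of_hasDerivWithinAt hv ?_
        (hasDerivWithinAt_comp_add_Icc hc (by linarith) (by linarith [hσ.2])) ?_ ?_ ?_
      · exact fun s hs => (hp s ⟨by linarith [hs.1, hσ.2], hs.2⟩).mono
          (Icc_subset_Icc_left (by linarith [hσ.2]))
      · exact fun s hs => hΦU _ hσV s ⟨by linarith [hs.1, hσ.2], hs.2⟩
      · exact fun s hs => hΦU _ h0V _ ⟨by linarith [hs.1], by linarith [hs.2, hσ.2]⟩
      · simp [hΦ0 _ hσV]
    have e2 : Φ (t - σ) (Φ σ 0) = 0 := by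
      have := e1 (x := t - σ) ⟨le_rfl, by linarith [hσ.1]⟩
      simpa [hfix] using this
    have e3 : EqOn (fun s => Φ s (Φ σ 0)) (fun s => Φ (s + (σ - t)) 0) (Icc t (t - σ)) := by
      refine eqOn_Icc_of_hasDerivWithinAt hv ?_
        (hasDerivWithinAt_comp_add_Icc hc (by linarith [hσ.1]) (by linarith)) ?_ ?_ ?_
      · exact fun s hs => (hp s ⟨hs.1, by linarith [hs.2, hσ.1]⟩).mono
          (Icc_subset_Icc_right (by linarith [hσ.1]))
      · exact fun s hs => hΦU _ hσV s ⟨hs.1, by linarith [hs.2, hσ.1]⟩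
      · exact fun s hs => hΦU _ h0V _ ⟨by linarith [hs.1, hσ.1], by linarith [hs.2]⟩
      · simp [e2, h00]
    have := e3 (x := t) ⟨le_rfl, by linarith [hσ.2]⟩
    simpa using this
  have hd0 : HasDerivWithinAt (fun s => Φ s 0) (v 0) (Icc t 0) 0 := by
    have := hc 0 ht0
    rwa [h00] at this
  have hd1 : HasDerivWithinAt (fun s => Φ t (Φ s 0)) (L (v 0)) (Icc t 0) 0 := by
    have hL' : HasFDerivAt (Φ t) L (Φ 0 0) := by rwa [h00]
    exact hL'.comp_hasDerivWithinAt 0 hd0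
  have hd2 : HasDerivWithinAt (fun s => Φ s 0) (L (v 0)) (Icc t 0) 0 :=
    hd1.congr_of_eventuallyEq (hperm.mono fun σ hσ => hσ.symm) (by simp [h00, hfix])
  exact h1 _ ((uniqueDiffOn_Icc ht 0 ht0).eq_deriv _ hd2 hd0)

/-- Backward orbits starting near a zero of a locally Lipschitz vector field stay near it. -/
theorem eventually_norm_flow_lt {E : Type*} [NormedAddCommGroup E] [NormedSpace ℝ E]
    {v : E → E} {r t ε : ℝ} {K : ℝ≥0} (hr : 0 < r) (hε : 0 < ε)
    (hv : LipschitzOnWith K v (Metric.ball 0 r)) (hv0 : v 0 = 0) {V : Set E} {Φ : ℝ → E → E}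
    (hV : IsOpen V) (h0V : 0 ∈ V) (hΦ0 : ∀ p ∈ V, Φ 0 p = p)
    (hΦ : ∀ p ∈ V, ∀ s ∈ Icc t 0,
      HasDerivWithinAt (fun s => Φ s p) (v (Φ s p)) (Icc t 0) s) :
    ∀ᶠ p in 𝓝 0, ∀ s ∈ Icc t 0, ‖Φ s p‖ < ε := by
  set ρ := min ε r
  have hρ : 0 < ρ := lt_min hε hr
  have hvb : ∀ z, ‖z‖ < ρ → ‖v z‖ ≤ K * ‖z‖ := by
    intro z hz
    have := hv.dist_le_mul z (by simpa using hz.trans_le (min_le_right _ _)) 0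
      (Metric.mem_ball_self hr)
    simpa [hv0] using this
  have hδ : 0 < ρ / Real.exp ((K + 1) * (-t)) := by positivity
  filter_upwards [hV.mem_nhds h0V, Metric.ball_mem_nhds (0 : E) hδ] with p hpV hp s hs
  refine (norm_lt_of_hasDerivWithinAt K.coe_nonneg
    (δ := ρ / Real.exp ((K + 1) * (-t))) ?_ hvb (hΦ p hpV) ?_ s hs).trans_le
    (min_le_left _ _)
  · rw [div_mul_cancel₀ _ (Real.exp_ne_zero _)]
  · simpa [hΦ0 p hpV] using hp

/-! ### Holomorphy near the origin -/

/-- A real-analytic germ killed by `X̄`, for a holomorphic vector field `X` contracting at `0`, is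
holomorphic. -/
theorem eventually_differentiableAt_of_conjVectorFieldApply_eq_zero {n : ℕ}
    {U : Set (EuclideanSpace ℂ (Fin n))} (hU : IsOpen U) (h0 : 0 ∈ U)
    {X : EuclideanSpace ℂ (Fin n) → EuclideanSpace ℂ (Fin n)}
    (hX : DifferentiableOn ℂ X U) (hcontr : IsContractingAtOrigin U X)
    {f : EuclideanSpace ℂ (Fin n) → ℂ} (hf : AnalyticAt ℝ f 0)
    (hXf : ∀ᶠ z in 𝓝 0, conjVectorFieldApply X f z = 0) :
    ∀ᶠ z in 𝓝 0, DifferentiableAt ℂ f z := by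
  obtain ⟨t, ht, V, Φ, hV, h0V, hflow, hfix, L, hL, hLμ⟩ := hcontr
  have hv : DifferentiableOn ℂ (reVelocity X) U := hX.const_smul (1 / 2 : ℂ)
  have hvlip : LocallyLipschitzOn U (reVelocity X) := by
    intro x hx
    obtain ⟨r, hr, K, -, hK⟩ := hv.exists_lipschitzOnWith_ball hU hx
    exact ⟨K, _, mem_nhdsWithin_of_mem_nhds (Metric.ball_mem_nhds x hr), hK⟩
  have hΦ0 : ∀ p ∈ V, Φ 0 p = p := fun p hp => (hflow p hp).1
  have hΦ : ∀ p ∈ V, ∀ s ∈ Icc t 0,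
      HasDerivWithinAt (fun s => Φ s p) (reVelocity X (Φ s p)) (Icc t 0) s :=
    fun p hp => (hflow p hp).2.2
  have hv0 : reVelocity X 0 = 0 := by
    refine eq_zero_of_flow_fixes_zero hvlip ht hV h0V hΦ0 (fun p hp => (hflow p hp).2.1) hΦ hfix
      (hL.restrictScalars ℝ) fun x hx => ?_
    by_contra hne
    have := hLμ 1 (Module.End.hasEigenvalue_of_hasEigenvector
      (Module.End.hasEigenvector_iff.2 ⟨Module.End.mem_eigenspace_iff.2 (by simpa using hx), hne⟩))
    simp at this
  obtain ⟨F, hF, hFf⟩ := hf.exists_polarization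
  set c := conjEuclidean n with hc
  have hc0 : Tendsto c (𝓝 0) (𝓝 0) := by simpa using c.continuous.tendsto 0
  have hgraph : Tendsto (fun z => (z, c z)) (𝓝 0)
      (𝓝 (0 : EuclideanSpace ℂ (Fin n) × EuclideanSpace ℂ (Fin n))) :=
    tendsto_id.prodMk_nhds hc0
  have hFan : ∀ᶠ x in 𝓝 0, AnalyticAt ℂ F x := hF.eventually_analyticAt
  let K : EuclideanSpace ℂ (Fin n) × EuclideanSpace ℂ (Fin n) → ℂ :=
    fun x => fderiv ℂ F x (0, c (X (c x.2)))
  have hK0 : ∀ᶠ x in 𝓝 0, K x = 0 := by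
    refine eventually_eq_zero_of_eq_zero_on_conj ?_ ?_
    · have hsnd : Tendsto (fun x : EuclideanSpace ℂ (Fin n) × EuclideanSpace ℂ (Fin n) => c x.2)
          (𝓝 0) (𝓝 0) := hc0.comp (continuous_snd.tendsto _)
      filter_upwards [hFan, hsnd.eventually (hU.eventually_mem h0)] with x hx hxU
      -- The two conjugations cancel, so `c ∘ X ∘ c` is holomorphic.
      have h1 : DifferentiableAt ℂ (c ∘ X ∘ c) x.2 :=
        DifferentiableAt.comp_semilinear₂ c c ((hX _ hxU).differentiableAt (hU.mem_nhds hxU))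
      have h2 : DifferentiableAt ℂ
          (fun x : EuclideanSpace ℂ (Fin n) × EuclideanSpace ℂ (Fin n) => c (X (c x.2))) x :=
        DifferentiableAt.comp (g := c ∘ X ∘ c) x h1 differentiableAt_snd
      exact hx.fderiv.differentiableAt.clm_apply ((differentiableAt_const _).prodMk h2)
    · filter_upwards [hgraph.eventually hFan, hFf.eventually_nhds, hXf] with z hz hzf hXz
      have := conjVectorFieldApply_eq_fderiv hz.differentiableAt hzf X
      simp only [K, ← hc] at this ⊢
      rw [hc, conjEuclidean_conjEuclidean, ← this, hXz]
  obtain ⟨δ, hδ, hball⟩ := Metric.eventually_nhds_iff_ball.1 (hFan.and hK0)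
  have hmem : ∀ z w : EuclideanSpace ℂ (Fin n), ‖z‖ < δ → ‖w‖ < δ →
      (z, c w) ∈ Metric.ball (0 : EuclideanSpace ℂ (Fin n) × EuclideanSpace ℂ (Fin n)) δ := by
    intro z w hz hw
    rw [mem_ball_zero_iff, Prod.norm_def]
    exact max_lt hz (by simpa [hc] using hw)
  -- Conjugating the second slot makes the relevant curves those of `Re X` itself.
  let H : EuclideanSpace ℂ (Fin n) → EuclideanSpace ℂ (Fin n) → ℂ := fun z w => F (z, c w)
  have hinv : ∀ᶠ w in 𝓝 0, ∀ z ∈ Metric.ball (0 : EuclideanSpace ℂ (Fin n)) δ,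
      H z (Φ t w) = H z w := by
    obtain ⟨r, hr, M, -, hM⟩ := hv.exists_lipschitzOnWith_ball hU h0
    filter_upwards [eventually_norm_flow_lt hr hδ hM hv0 hV h0V hΦ0 hΦ, hV.eventually_mem h0V]
      with w hw hwV z hz
    rw [mem_ball_zero_iff] at hz
    have hder : ∀ s ∈ Icc t 0, HasDerivWithinAt (fun s => H z (Φ s w)) 0 (Icc t 0) s := by
      intro s hs
      obtain ⟨hFa, hKz⟩ := hball _ (hmem z (Φ s w) hz (hw s hs))
      have h1 : HasDerivWithinAt (fun s => c (Φ s w)) (c (reVelocity X (Φ s w))) (Icc t 0) s :=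
        (conjEuclideanReal n).hasFDerivAt.comp_hasDerivWithinAt s (hΦ w hwV s hs)
      have h2 : HasDerivWithinAt (fun s => (z, c (Φ s w))) (0, c (reVelocity X (Φ s w)))
          (Icc t 0) s := (hasDerivWithinAt_const s _ z).prodMk h1
      have h3 : HasDerivWithinAt (fun s => H z (Φ s w))
          (fderiv ℂ F (z, c (Φ s w)) (0, c (reVelocity X (Φ s w)))) (Icc t 0) s :=
        HasFDerivAt.comp_hasDerivWithinAt (l := F)
          (l' := (fderiv ℂ F (z, c (Φ s w))).restrictScalars ℝ) s
          (hFa.differentiableAt.hasFDerivAt.restrictScalars ℝ) h2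
      have h4 : fderiv ℂ F (z, c (Φ s w)) (0, c (X (Φ s w))) = 0 := by
        simpa [K, hc] using hKz
      have h5 : ((0 : EuclideanSpace ℂ (Fin n)), c (reVelocity X (Φ s w))) =
          (starRingEnd ℂ) (1 / 2 : ℂ) • ((0 : EuclideanSpace ℂ (Fin n)), c (X (Φ s w))) := by
        rw [reVelocity, map_smulₛₗ, Prod.smul_mk, smul_zero]
      rwa [h5, map_smul, h4, smul_zero] at h3
    have hconst := (convex_Icc t 0).is_const_of_fderivWithin_eq_zero (𝕜 := ℝ)
      (fun s hs => (hder s hs).differentiableWithinAt)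
      (fun s hs => by
        have := (hder s hs).hasFDerivWithinAt.fderivWithin (uniqueDiffOn_Icc ht s hs)
        simpa using this)
      (left_mem_Icc.2 ht.le) (right_mem_Icc.2 ht.le)
    simpa [hΦ0 w hwV] using hconst
  have hcont : ∀ z ∈ Metric.ball (0 : EuclideanSpace ℂ (Fin n)) δ, ContinuousAt (H z) 0 := by
    intro z hz
    rw [mem_ball_zero_iff] at hz
    have h1 := (hball _ (hmem z 0 hz (by simpa using hδ))).1.continuousAt
    exact ContinuousAt.comp (g := F) (f := fun w => (z, c w)) h1
      (by have := c.continuous; fun_prop)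
  -- The neighborhood of admissible `w` is uniform in `z`, which permits `w = z` next.
  have hconst := eventually_eq_of_invariant hfix hL hLμ hcont hinv
  have hfeq : ∀ᶠ z in 𝓝 0, f z = F (z, 0) := by
    filter_upwards [hconst, hFf, Metric.ball_mem_nhds (0 : EuclideanSpace ℂ (Fin n)) hδ]
      with z h1 h2 hz
    rw [← h2]
    simpa [H] using h1 z hz
  filter_upwards [hfeq.eventually_nhds, Metric.ball_mem_nhds (0 : EuclideanSpace ℂ (Fin n)) hδ]
    with z hz hzδ
  rw [mem_ball_zero_iff] at hzδ
  have h1 := (hball _ (hmem z 0 hzδ (by simpa using hδ))).1.differentiableAt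
  rw [map_zero] at h1
  exact DifferentiableAt.congr_of_eventuallyEq
    (DifferentiableAt.comp (g := F) (f := fun z => (z, 0)) z h1 (by fun_prop)) hz

/-! ### From the germ to the ball -/

/-- A real-differentiable function whose derivative commutes with multiplication by `i` is
complex-differentiable. -/
theorem differentiableAt_complex_of_fderiv_I {E : Type*} [NormedAddCommGroup E] [NormedSpace ℂ E]
    {f : E → ℂ} {z : E} (hf : DifferentiableAt ℝ f z)
    (hI : ∀ v, fderiv ℝ f z (Complex.I • v) = Complex.I * fderiv ℝ f z v) :
    DifferentiableAt ℂ f z := by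
  rw [differentiableAt_iff_restrictScalars ℝ hf]
  refine ⟨{ toFun := fderiv ℝ f z, map_add' := map_add _, map_smul' := fun c v => ?_,
            cont := (fderiv ℝ f z).continuous }, rfl⟩
  have hcv : c • v = c.re • v + c.im • (Complex.I • v) := by
    conv_lhs => rw [← Complex.re_add_im c]
    rw [add_smul, mul_smul]
    rfl
  rw [hcv, map_add, map_smul, map_smul, hI]
  simp only [Complex.real_smul, RingHom.id_apply, smul_eq_mul]
  linear_combination fderiv ℝ f z v * Complex.re_add_im c

theorem mainTheorem3 (n : ℕ)
    (U : Set (EuclideanSpace ℂ (Fin n))) (hU : IsOpen U) (h0 : 0 ∈ U)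
    (X : EuclideanSpace ℂ (Fin n) → EuclideanSpace ℂ (Fin n))
    (hX : DifferentiableOn ℂ X U) (hcontr : IsContractingAtOrigin U X)
    (f : EuclideanSpace ℂ (Fin n) → ℂ)
    (hf : AnalyticOnNhd ℝ f (Metric.ball (0 : EuclideanSpace ℂ (Fin n)) 1))
    (hXf : ∀ z ∈ U ∩ Metric.ball (0 : EuclideanSpace ℂ (Fin n)) 1,
      conjVectorFieldApply X f z = 0) :
    DifferentiableOn ℂ f (Metric.ball (0 : EuclideanSpace ℂ (Fin n)) 1) := by
  have h01 : (0 : EuclideanSpace ℂ (Fin n)) ∈ Metric.ball 0 1 := Metric.mem_ball_self one_pos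
  have hlocal := eventually_differentiableAt_of_conjVectorFieldApply_eq_zero hU h0 hX hcontr
    (hf 0 h01) (eventually_of_mem
      ((hU.inter Metric.isOpen_ball).mem_nhds ⟨h0, h01⟩) hXf)
  -- The Cauchy–Riemann defect is real-analytic on the connected ball and vanishes near 0.
  have key : ∀ v, EqOn (fun z => fderiv ℝ f z (Complex.I • v) - Complex.I * fderiv ℝ f z v) 0
      (Metric.ball 0 1) := by
    intro v
    refine AnalyticOnNhd.eqOn_of_preconnected_of_eventuallyEq (𝕜 := ℝ) ?_ analyticOnNhd_const
      (convex_ball (0 : EuclideanSpace ℂ (Fin n)) 1).isPreconnected h01 ?_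
    · intro z hz
      have h1 : ∀ w, AnalyticAt ℝ (fun z => fderiv ℝ f z w) z := fun w =>
        ((ContinuousLinearMap.apply ℝ ℂ w).analyticAt _).comp (hf z hz).fderiv
      exact (h1 _).sub (analyticAt_const.mul (h1 _))
    · filter_upwards [hlocal] with z hz
      have h1 : fderiv ℝ f z = (fderiv ℂ f z).restrictScalars ℝ :=
        (hz.hasFDerivAt.restrictScalars ℝ).fderiv
      simp [h1]
  exact fun z hz => (differentiableAt_complex_of_fderiv_I (hf z hz).differentiableAt
    fun v => sub_eq_zero.1 (key v hz)).differentiableWithinAt
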